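/- **Theorem 6.4.** Let $d\in\mathbb{N}$ and let $\Omega\subseteq\mathbb{R}^d$ be open. Let $p:\Omega\to[1,\infty)$ be a measurable function with $p^+:=\operatorname{ess\,sup}_\Omega p<\infty$ and $p^-:=\operatorname{ess\,inf}_\Omega p>1$. Let $\sigma$ be a weight on $\mathbb{R}^d$, that is, a locally integrable function with $0<\sigma(x)<\infty$ for a.e. $x\in\mathbb{R}^d$. For a measurable function $u$ on $\Omega$ with values in $\mathbb{R}$ or $\mathbb{R}^d$ ($|\cdot|$ being the absolute value or the Euclidean norm) put $$\rho_{p(\cdot),\sigma}(u):=\int_\Omega |u(x)|^{p(x)}\sigma(x)\,dx,\qquad \|u\|_{p(\cdot),\sigma}:=\inf\{\lambda>0 \mid \rho_{p(\cdot),\sigma}(u/\lambda)\le 1\},$$ and write $u\in L^{p(\cdot)}(\Omega;\sigma)$ if $\rho_{p(\cdot),\sigma}(u)<\infty$. Assume that $\sigma$ is admissible, i.e., that whenever $(\varphi_n)_{n\in\mathbb{N}}\subseteq C^\infty(\Omega)$ and $\mathbf v\in L^{p(\cdot)}(\Omega;\sigma)$ (with values in $\mathbb{R}^d$) satisfy $\rho_{p(\cdot),\sigma}(\varphi_n)\to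 0$ and $\rho_{p(\cdot),\sigma}(\nabla\varphi_n-\mathbf v)\to 0$ as $n\to\infty$, then $\mathbf v=\mathbf 0$ a.e. in $\Omega$. Let $H^{1,p(\cdot)}(\Omega;\sigma)$ be the completion of $$\mathcal V_{p(\cdot),\sigma}:=\{u\in C^\infty(\Omega)\mid \|u\|_{1,p(\cdot),\sigma}<\infty\}$$ with respect to the norm $\|u\|_{1,p(\cdot),\sigma}:=\|u\|_{p(\cdot),\sigma}+\|\nabla u\|_{p(\cdot),\sigma}$. Then $H^{1,p(\cdot)}(\Omega;\sigma)$ is a separable and reflexive Banach space. -/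

import Mathlib

open MeasureTheory Filter Topology TopologicalSpace
open scoped ENNReal ContDiff Gradient

noncomputable section

namespace WeightedVariableSobolev

/-- The set `𝒫^∞(Ω)` of bounded variable exponents: (Lebesgue) measurable functions
`p : Ω → [1, ∞)` with `p⁺ = ess sup_Ω p < ∞`. An exponent is stored as a function on the whole
space, but only its values on `Ω` are constrained and used. -/
structure BoundedExponent {d : ℕ} (Ω : Opens (EuclideanSpace ℝ (Fin d))) where
  toFun : EuclideanSpace ℝ (Fin d) → ℝ
  aemeasurable : AEMeasurable toFun (volume.restrict (Ω : Set (EuclideanSpace ℝ (Fin d))))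
  one_le : ∀ x ∈ Ω, 1 ≤ toFun x
  essSup_lt_top : essSup (fun x => ENNReal.ofReal (toFun x))
    (volume.restrict (Ω : Set (EuclideanSpace ℝ (Fin d)))) < ⊤

/-- `p⁻ = ess inf_Ω p`, as an element of `[0, ∞]` (it is `∞` when `Ω` is empty). -/
def BoundedExponent.lower {d : ℕ} {Ω : Opens (EuclideanSpace ℝ (Fin d))}
    (p : BoundedExponent Ω) : ℝ≥0∞ :=
  essInf (fun x => ENNReal.ofReal (p.toFun x))
    (volume.restrict (Ω : Set (EuclideanSpace ℝ (Fin d))))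

/-- A weight on `ℝ^d`: a locally integrable function that is positive (and finite) a.e. -/
structure Weight (d : ℕ) where
  toFun : EuclideanSpace ℝ (Fin d) → ℝ
  locallyIntegrable : LocallyIntegrable toFun volume
  ae_pos : ∀ᵐ x ∂(volume : Measure (EuclideanSpace ℝ (Fin d))), 0 < toFun x

variable {d : ℕ} {Ω : Opens (EuclideanSpace ℝ (Fin d))}

section Lebesgue

set_option linter.unusedSectionVars false

variable {F : Type*} [NormedAddCommGroup F] [NormedSpace ℝ F]

/-- The modular `ρ_{p(·),σ}(u) = ∫_Ω |u(x)|^{p(x)} σ(x) dx ∈ [0, ∞]`. -/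
def modular (p : BoundedExponent Ω) (σ : Weight d)
    (u : EuclideanSpace ℝ (Fin d) → F) : ℝ≥0∞ :=
  ∫⁻ x in (Ω : Set (EuclideanSpace ℝ (Fin d))),
    ENNReal.ofReal (‖u x‖ ^ p.toFun x * σ.toFun x)

/-- The Luxemburg norm `‖u‖_{p(·),σ} = inf {s > 0 | ρ_{p(·),σ}(u / s) ≤ 1} ∈ [0, ∞]`. -/
def luxNorm (p : BoundedExponent Ω) (σ : Weight d)
    (u : EuclideanSpace ℝ (Fin d) → F) : ℝ≥0∞ :=
  ⨅ (s : ℝ) (_ : 0 < s ∧ modular p σ (fun x => s⁻¹ • u x) ≤ 1), ENNReal.ofReal s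

/-- `u ∈ L^{p(·)}(Ω; σ)`: `u` is (Lebesgue) measurable on `Ω` and its modular is finite. -/
def MemLebesgue (p : BoundedExponent Ω) (σ : Weight d)
    (u : EuclideanSpace ℝ (Fin d) → F) : Prop :=
  AEStronglyMeasurable u (volume.restrict (Ω : Set (EuclideanSpace ℝ (Fin d)))) ∧
    modular p σ u < ⊤

lemma modular_congr (p : BoundedExponent Ω) (σ : Weight d)
    {u v : EuclideanSpace ℝ (Fin d) → F} (h : ∀ x ∈ Ω, u x = v x) :
    modular p σ u = modular p σ v := by
  unfold modular
  refine setLIntegral_congr_fun Ω.isOpen.measurableSet ?_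
  intro x hx
  simp only [h x hx]

lemma luxNorm_congr (p : BoundedExponent Ω) (σ : Weight d)
    {u v : EuclideanSpace ℝ (Fin d) → F} (h : ∀ x ∈ Ω, u x = v x) :
    luxNorm p σ u = luxNorm p σ v := by
  unfold luxNorm
  have : ∀ s : ℝ, modular p σ (fun x => s⁻¹ • u x) = modular p σ (fun x => s⁻¹ • v x) :=
    fun s => modular_congr p σ fun x hx => by rw [h x hx]
  simp only [this]

lemma modular_zero (p : BoundedExponent Ω) (σ : Weight d) :
    modular p σ (fun _ => (0 : F)) = 0 := by
  unfold modular
  rw [setLIntegral_congr_fun (g := fun _ => 0) Ω.isOpen.measurableSet]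
  · simp
  · intro x hx
    have := p.one_le x hx
    simp [Real.zero_rpow (by linarith : p.toFun x ≠ 0)]

lemma luxNorm_zero (p : BoundedExponent Ω) (σ : Weight d) :
    luxNorm p σ (fun _ => (0 : F)) = 0 := by
  refine le_antisymm (ENNReal.le_of_forall_pos_le_add fun ε hε _ => ?_) bot_le
  refine (iInf₂_le (ε : ℝ) ⟨by exact_mod_cast hε, ?_⟩).trans (by simp)
  simp [modular_zero]

lemma luxNorm_smul_le (p : BoundedExponent Ω) (σ : Weight d) {c : ℝ} (hc : c ≠ 0)
    (u : EuclideanSpace ℝ (Fin d) → F) :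
    luxNorm p σ (fun x => c • u x) ≤ ENNReal.ofReal |c| * luxNorm p σ u := by
  have hc' : 0 < |c| := abs_pos.mpr hc
  have h0 : ENNReal.ofReal |c| ≠ 0 := by simpa using hc
  conv_rhs => unfold luxNorm
  rw [ENNReal.mul_iInf_of_ne h0 ENNReal.ofReal_ne_top]
  refine le_iInf fun s => ?_
  rw [ENNReal.mul_iInf_of_ne h0 ENNReal.ofReal_ne_top]
  refine le_iInf fun hs => ?_
  rw [← ENNReal.ofReal_mul hc'.le]
  refine iInf₂_le (|c| * s) ⟨mul_pos hc' hs.1, le_of_eq_of_le ?_ hs.2⟩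
  unfold modular
  congr 1
  ext x
  congr 3
  simp only [norm_smul, norm_inv, norm_mul, Real.norm_eq_abs, abs_abs]
  field_simp

lemma luxNorm_smul (p : BoundedExponent Ω) (σ : Weight d) (c : ℝ)
    (u : EuclideanSpace ℝ (Fin d) → F) :
    luxNorm p σ (fun x => c • u x) = ENNReal.ofReal |c| * luxNorm p σ u := by
  rcases eq_or_ne c 0 with rfl | hc
  · simp [luxNorm_zero]
  refine le_antisymm (luxNorm_smul_le p σ hc u) ?_
  have h := luxNorm_smul_le p σ (inv_ne_zero hc) (fun x => c • u x)
  simp only [smul_smul, inv_mul_cancel₀ hc, one_smul] at h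
  calc ENNReal.ofReal |c| * luxNorm p σ u
      ≤ ENNReal.ofReal |c| * (ENNReal.ofReal |c⁻¹| * luxNorm p σ (fun x => c • u x)) := by
        gcongr
    _ = luxNorm p σ (fun x => c • u x) := by
        rw [← mul_assoc, ← ENNReal.ofReal_mul (abs_nonneg c), ← abs_mul, mul_inv_cancel₀ hc]
        simp

lemma modular_convex (p : BoundedExponent Ω) (σ : Weight d)
    {u v : EuclideanSpace ℝ (Fin d) → F}
    (hu : AEStronglyMeasurable u (volume.restrict (Ω : Set (EuclideanSpace ℝ (Fin d)))))
    {a b : ℝ} (ha : 0 ≤ a) (hb : 0 ≤ b) (hab : a + b = 1) :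
    modular p σ (fun x => a • u x + b • v x) ≤
      ENNReal.ofReal a * modular p σ u + ENNReal.ofReal b * modular p σ v := by
  unfold modular
  rw [← lintegral_const_mul' _ _ ENNReal.ofReal_ne_top,
    ← lintegral_const_mul' _ _ ENNReal.ofReal_ne_top, ← lintegral_add_left']
  · refine lintegral_mono_ae ?_
    filter_upwards [ae_restrict_mem Ω.isOpen.measurableSet, ae_restrict_of_ae σ.ae_pos]
      with x hx hσ
    have hp := p.one_le x hx
    have h1 : ‖a • u x + b • v x‖ ≤ a * ‖u x‖ + b * ‖v x‖ := by
      refine (norm_add_le _ _).trans ?_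
      simp [norm_smul, abs_of_nonneg ha, abs_of_nonneg hb]
    have h2 : ‖a • u x + b • v x‖ ^ p.toFun x ≤
        a * ‖u x‖ ^ p.toFun x + b * ‖v x‖ ^ p.toFun x := by
      refine (Real.rpow_le_rpow (norm_nonneg _) h1 (by linarith)).trans ?_
      have := (convexOn_rpow hp).2 (Set.mem_Ici.mpr (norm_nonneg (u x)))
        (Set.mem_Ici.mpr (norm_nonneg (v x))) ha hb hab
      simpa using this
    rw [← ENNReal.ofReal_mul ha, ← ENNReal.ofReal_mul hb, ← ENNReal.ofReal_add]
    · refine ENNReal.ofReal_le_ofReal ?_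
      nlinarith [mul_le_mul_of_nonneg_right h2 hσ.le]
    · positivity
    · positivity
  · have hσ : AEMeasurable σ.toFun
        (volume.restrict (Ω : Set (EuclideanSpace ℝ (Fin d)))) :=
      σ.locallyIntegrable.aestronglyMeasurable.aemeasurable.restrict
    exact (((hu.norm.aemeasurable.pow p.aemeasurable).mul hσ).ennreal_ofReal).const_mul _

lemma luxNorm_add_le (p : BoundedExponent Ω) (σ : Weight d)
    {u v : EuclideanSpace ℝ (Fin d) → F}
    (hu : AEStronglyMeasurable u (volume.restrict (Ω : Set (EuclideanSpace ℝ (Fin d))))) :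
    luxNorm p σ (fun x => u x + v x) ≤ luxNorm p σ u + luxNorm p σ v := by
  conv_rhs => unfold luxNorm
  simp only [ENNReal.iInf_add, ENNReal.add_iInf]
  refine le_iInf fun t => le_iInf fun ht => le_iInf fun s => le_iInf fun hs => ?_
  obtain ⟨hs0, hs1⟩ := hs
  obtain ⟨ht0, ht1⟩ := ht
  have hst : 0 < s + t := add_pos hs0 ht0
  rw [← ENNReal.ofReal_add hs0.le ht0.le]
  refine iInf₂_le (s + t) ⟨hst, ?_⟩
  have hab : s / (s + t) + t / (s + t) = 1 := by field_simp
  have key := modular_convex p σ (v := fun x => t⁻¹ • v x) (hu.const_smul s⁻¹)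
    (div_nonneg hs0.le hst.le) (div_nonneg ht0.le hst.le) hab
  have e : (fun x => (s + t)⁻¹ • (u x + v x)) =
      fun x => (s / (s + t)) • (s⁻¹ • u) x + (t / (s + t)) • t⁻¹ • v x := by
    ext x
    simp only [Pi.smul_apply, smul_smul, smul_add]
    congr 2 <;> field_simp
  rw [e]
  refine key.trans ?_
  calc _ ≤ ENNReal.ofReal (s / (s + t)) * 1 + ENNReal.ofReal (t / (s + t)) * 1 := by
        gcongr
        exact hs1
    _ = 1 := by
        rw [mul_one, mul_one, ← ENNReal.ofReal_add (div_nonneg hs0.le hst.le)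
          (div_nonneg ht0.le hst.le), hab, ENNReal.ofReal_one]

end Lebesgue

/-- The weight `σ` is admissible (for `Ω` and `p`): whenever `φ_n ∈ C^∞(Ω)` tend to `0` and
`∇φ_n` tend to `v ∈ L^{p(·)}(Ω; σ)^d`, both in the sense of the modular, then `v = 0` in
`L^{p(·)}(Ω; σ)^d` (that is, a.e. in `Ω`, the weight being positive a.e.). -/
def Admissible (p : BoundedExponent Ω) (σ : Weight d) : Prop :=
  ∀ (φ : ℕ → EuclideanSpace ℝ (Fin d) → ℝ)
    (v : EuclideanSpace ℝ (Fin d) → EuclideanSpace ℝ (Fin d)),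
    (∀ n, ContDiffOn ℝ ∞ (φ n) (Ω : Set (EuclideanSpace ℝ (Fin d)))) →
    MemLebesgue p σ v →
    Tendsto (fun n => modular p σ (φ n)) atTop (𝓝 0) →
    Tendsto (fun n => modular p σ (fun x => ∇ (φ n) x - v x)) atTop (𝓝 0) →
    v =ᵐ[volume.restrict (Ω : Set (EuclideanSpace ℝ (Fin d)))] 0

/-- `‖u‖_{1,p(·),σ} = ‖u‖_{p(·),σ} + ‖∇u‖_{p(·),σ} ∈ [0, ∞]`, for `u ∈ C^∞(Ω)`. -/
def sobolevNorm (p : BoundedExponent Ω) (σ : Weight d)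
    (u : EuclideanSpace ℝ (Fin d) → ℝ) : ℝ≥0∞ :=
  luxNorm p σ u + luxNorm p σ (fun x => ∇ u x)

lemma gradient_add' {u v : EuclideanSpace ℝ (Fin d) → ℝ}
    (hu : ContDiffOn ℝ ∞ u (Ω : Set (EuclideanSpace ℝ (Fin d))))
    (hv : ContDiffOn ℝ ∞ v (Ω : Set (EuclideanSpace ℝ (Fin d))))
    (x : EuclideanSpace ℝ (Fin d)) (hx : x ∈ Ω) :
    ∇ (u + v) x = ∇ u x + ∇ v x := by
  have h1 := (hu.contDiffAt (Ω.isOpen.mem_nhds hx)).differentiableAt (by simp)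
  have h2 := (hv.contDiffAt (Ω.isOpen.mem_nhds hx)).differentiableAt (by simp)
  unfold gradient
  rw [fderiv_add h1 h2, map_add]

lemma gradient_smul' (c : ℝ) {u : EuclideanSpace ℝ (Fin d) → ℝ}
    (hu : ContDiffOn ℝ ∞ u (Ω : Set (EuclideanSpace ℝ (Fin d))))
    (x : EuclideanSpace ℝ (Fin d)) (hx : x ∈ Ω) :
    ∇ (c • u) x = c • ∇ u x := by
  have h1 := (hu.contDiffAt (Ω.isOpen.mem_nhds hx)).differentiableAt (by simp)
  unfold gradient
  rw [fderiv_const_smul h1]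
  simp

lemma sobolevNorm_zero (p : BoundedExponent Ω) (σ : Weight d) :
    sobolevNorm p σ (0 : EuclideanSpace ℝ (Fin d) → ℝ) = 0 := by
  have h : (fun x => ∇ (0 : EuclideanSpace ℝ (Fin d) → ℝ) x) =
      fun _ => (0 : EuclideanSpace ℝ (Fin d)) := by
    ext1 x
    simp [gradient]
  unfold sobolevNorm
  rw [h, luxNorm_zero, add_zero]
  exact luxNorm_zero p σ

lemma sobolevNorm_smul (p : BoundedExponent Ω) (σ : Weight d) (c : ℝ)
    {u : EuclideanSpace ℝ (Fin d) → ℝ}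
    (hu : ContDiffOn ℝ ∞ u (Ω : Set (EuclideanSpace ℝ (Fin d)))) :
    sobolevNorm p σ (c • u) = ENNReal.ofReal |c| * sobolevNorm p σ u := by
  unfold sobolevNorm
  rw [luxNorm_congr p σ (gradient_smul' c hu), luxNorm_smul, mul_add, ← luxNorm_smul p σ c u]
  rfl

lemma sobolevNorm_add_le (p : BoundedExponent Ω) (σ : Weight d)
    {u v : EuclideanSpace ℝ (Fin d) → ℝ}
    (hu : ContDiffOn ℝ ∞ u (Ω : Set (EuclideanSpace ℝ (Fin d))))
    (hv : ContDiffOn ℝ ∞ v (Ω : Set (EuclideanSpace ℝ (Fin d)))) :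
    sobolevNorm p σ (u + v) ≤ sobolevNorm p σ u + sobolevNorm p σ v := by
  have m1 : AEStronglyMeasurable u
      (volume.restrict (Ω : Set (EuclideanSpace ℝ (Fin d)))) :=
    hu.continuousOn.aestronglyMeasurable Ω.isOpen.measurableSet
  have m2 : AEStronglyMeasurable (fun x => ∇ u x)
      (volume.restrict (Ω : Set (EuclideanSpace ℝ (Fin d)))) := by
    refine ContinuousOn.aestronglyMeasurable ?_ Ω.isOpen.measurableSet
    exact (InnerProductSpace.toDual ℝ _).symm.continuous.comp_continuousOn
      (hu.continuousOn_fderiv_of_isOpen Ω.isOpen (by simp))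
  unfold sobolevNorm
  rw [luxNorm_congr p σ (gradient_add' hu hv), add_add_add_comm]
  exact add_le_add (luxNorm_add_le p σ m1) (luxNorm_add_le p σ m2)

/-- The vector space `𝒱_{p(·),σ} = {u ∈ C^∞(Ω) | ‖u‖_{1,p(·),σ} < ∞}`. A function on `Ω` is
represented by its extension by zero to the whole space. -/
def smoothSubmodule (p : BoundedExponent Ω) (σ : Weight d) :
    Submodule ℝ (EuclideanSpace ℝ (Fin d) → ℝ) where
  carrier := {u | ContDiffOn ℝ ∞ u (Ω : Set (EuclideanSpace ℝ (Fin d))) ∧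
    (∀ x ∉ Ω, u x = 0) ∧ sobolevNorm p σ u < ⊤}
  zero_mem' := ⟨contDiffOn_const, fun _ _ => rfl, by simp [sobolevNorm_zero]⟩
  add_mem' := by
    rintro u v ⟨hu, hu0, hu1⟩ ⟨hv, hv0, hv1⟩
    exact ⟨hu.add hv, fun x hx => by simp [hu0 x hx, hv0 x hx],
      (sobolevNorm_add_le p σ hu hv).trans_lt (ENNReal.add_lt_top.2 ⟨hu1, hv1⟩)⟩
  smul_mem' := by
    rintro c u ⟨hu, hu0, hu1⟩
    refine ⟨hu.const_smul c, fun x hx => by simp [hu0 x hx], ?_⟩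
    rw [sobolevNorm_smul p σ c hu]
    exact ENNReal.mul_lt_top ENNReal.ofReal_lt_top hu1

/-- The space `𝒱_{p(·),σ}` as a type of its own, so that its only topology is the one of the norm
`‖·‖_{1,p(·),σ}` (and not that of pointwise convergence). -/
def SmoothSpace (p : BoundedExponent Ω) (σ : Weight d) : Type :=
  ↥(smoothSubmodule p σ)

instance (p : BoundedExponent Ω) (σ : Weight d) : AddCommGroup (SmoothSpace p σ) :=
  inferInstanceAs (AddCommGroup ↥(smoothSubmodule p σ))

instance (p : BoundedExponent Ω) (σ : Weight d) : Module ℝ (SmoothSpace p σ) :=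
  inferInstanceAs (Module ℝ ↥(smoothSubmodule p σ))

instance (p : BoundedExponent Ω) (σ : Weight d) : Norm (SmoothSpace p σ) where
  norm u := (sobolevNorm p σ u.1).toReal

lemma SmoothSpace.norm_def {p : BoundedExponent Ω} {σ : Weight d} (u : SmoothSpace p σ) :
    ‖u‖ = (sobolevNorm p σ u.1).toReal := rfl

lemma SmoothSpace.core (p : BoundedExponent Ω) (σ : Weight d) :
    SeminormedSpace.Core ℝ (SmoothSpace p σ) where
  norm_nonneg _ := ENNReal.toReal_nonneg
  norm_smul c u := by
    have h : sobolevNorm p σ (c • u : SmoothSpace p σ).1 =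
        ENNReal.ofReal |c| * sobolevNorm p σ u.1 := sobolevNorm_smul p σ c u.2.1
    rw [SmoothSpace.norm_def, SmoothSpace.norm_def, h, ENNReal.toReal_mul,
      ENNReal.toReal_ofReal (abs_nonneg c), Real.norm_eq_abs]
  norm_triangle u v := by
    have h : sobolevNorm p σ (u + v : SmoothSpace p σ).1 ≤
        sobolevNorm p σ u.1 + sobolevNorm p σ v.1 := sobolevNorm_add_le p σ u.2.1 v.2.1
    rw [SmoothSpace.norm_def, SmoothSpace.norm_def, SmoothSpace.norm_def,
      ← ENNReal.toReal_add u.2.2.2.ne v.2.2.2.ne]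
    exact ENNReal.toReal_mono (ENNReal.add_ne_top.2 ⟨u.2.2.2.ne, v.2.2.2.ne⟩) h

instance (p : BoundedExponent Ω) (σ : Weight d) : SeminormedAddCommGroup (SmoothSpace p σ) :=
  SeminormedAddCommGroup.ofCore (SmoothSpace.core p σ)

instance (p : BoundedExponent Ω) (σ : Weight d) : NormedSpace ℝ (SmoothSpace p σ) where
  norm_smul_le c u := ((SmoothSpace.core p σ).norm_smul c u).le

/-- The weighted variable exponent Sobolev space `H^{1,p(·)}(Ω; σ)`: the completion of
`𝒱_{p(·),σ}` with respect to `‖·‖_{1,p(·),σ}`. -/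
abbrev H1 (p : BoundedExponent Ω) (σ : Weight d) : Type :=
  UniformSpace.Completion (SmoothSpace p σ)

/-- A real normed space is reflexive if the canonical map into its bidual is onto. -/
def IsReflexive (X : Type*) [NormedAddCommGroup X] [NormedSpace ℝ X] : Prop :=
  Function.Surjective (NormedSpace.inclusionInDoubleDual ℝ X)

end WeightedVariableSobolev

end

/-! Completeness is built into the completion. The other two properties are checked on the dense
space of smooth functions, so limit elements never have to be realised as functions.

Separability: the Mazur map `u ↦ σ |u| ^ (p - 1) u` sends functions and gradients of finite modular
into the separable space `L¹`. Its inverse is uniformly continuous, since `norm_sub_rpow_le_mazur`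
bounds the modular of a difference by the `L¹` distance of the images.

Reflexivity: a Milman–Pettis argument run with the energy `ρ(u) + ρ(∇u)` instead of the norm
(`isReflexive_of_uniformlyConvex`). For `ξ` in the bidual, Helly's lemma provides bounded smooth
functions on which any given finite set of functionals nearly agrees with `ξ`. Those of almost least
energy form a Cauchy net, by uniform convexity, and the limit represents `ξ`. Uniform convexity of
the energy is the integral of a pointwise inequality (`exists_rpow_convexity_defect`), whose
constant is uniform for exponents in a compact subinterval of `(1, ∞)`; this is where `p⁻ > 1` and
`p⁺ < ∞` are needed. -/

open MeasureTheory Filter Topology TopologicalSpace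
open scoped ENNReal ContDiff Gradient

noncomputable section

namespace WeightedVariableSobolev

/-! ### Helly's lemma and a Milman–Pettis criterion -/

section Reflexivity

variable {X V : Type*} [NormedAddCommGroup X] [NormedSpace ℝ X] [AddCommGroup V] [Module ℝ V]

/-- Helly's lemma: on finitely many functionals, an element of the bidual is approximated by
bounded elements of a dense subspace. -/
lemma exists_approx_bidual (ι : V →ₗ[ℝ] X) (hι : DenseRange ι)
    (ξ : StrongDual ℝ (StrongDual ℝ X)) (A : Finset (StrongDual ℝ X)) :
    ∃ v : V, ‖ι v‖ ≤ ‖ξ‖ + 1 ∧ ∀ f ∈ A, |ξ f - f (ι v)| ≤ 1 := by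
  classical
  set R : ℝ := ‖ξ‖ + 1 with hR
  have hR0 : 0 < R := by positivity
  let T : V →ₗ[ℝ] (A → ℝ) := LinearMap.pi fun g => (g.1 : X →ₗ[ℝ] ℝ) ∘ₗ ι
  have hT : ∀ v g, T v g = g.1 (ι v) := fun v g => rfl
  let S : Set V := {v | ‖ι v‖ ≤ R}
  have hS : Convex ℝ S := by
    have h : S = ι ⁻¹' Metric.closedBall 0 R := by ext v; simp [S]
    rw [h]
    exact (convex_closedBall _ _).linear_preimage ι
  let y : A → ℝ := fun g => ξ g.1
  have hy : y ∈ closure (T '' S) := by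
    -- A functional `F` separating `y` from `T '' S` pulls back to `h` in the dual with `h < u` on
    -- the ball of radius `R`. Hence `‖h‖ ≤ u / R`, so `ξ h ≤ u`, against `u < F y = ξ h`. The `+ 1`
    -- in `R` keeps it positive when `ξ = 0`.
    by_contra hy
    obtain ⟨F, u, h1, h2⟩ := geometric_hahn_banach_closed_point (hS.linear_image T).closure
      isClosed_closure hy
    let h : StrongDual ℝ X := ∑ g : A, F (Pi.single g 1) • g.1
    have hF : ∀ z : A → ℝ, F z = ∑ g : A, z g * F (Pi.single g 1) := by
      intro z
      conv_lhs => rw [← Finset.univ_sum_single z]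
      rw [map_sum]
      refine Finset.sum_congr rfl fun g _ => ?_
      have : (Pi.single g (z g) : A → ℝ) = z g • Pi.single g 1 := by
        rw [← Pi.single_smul]; simp
      rw [this, map_smul, smul_eq_mul]
    have hFT : ∀ v, F (T v) = h (ι v) := by
      intro v
      rw [hF]
      simp only [h, hT, sum_apply, smul_apply, smul_eq_mul, mul_comm]
    have hFy : F y = ξ h := by
      rw [hF]
      simp only [h, y, map_sum, map_smul, smul_eq_mul, mul_comm]
    have hb : ∀ v ∈ S, h (ι v) < u := fun v hv =>
      hFT v ▸ h1 _ (subset_closure (Set.mem_image_of_mem T hv))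
    have hu : 0 < u := by simpa using hb 0 (by simp [S, hR0.le])
    have hle : ∀ v, h (ι v) ≤ u / R * ‖ι v‖ := by
      intro v
      rcases eq_or_ne (ι v) 0 with h0 | h0
      · simp [h0]
      have hn : 0 < ‖ι v‖ := norm_pos_iff.2 h0
      have := hb ((R / ‖ι v‖) • v) (by
        simp [S, norm_smul, abs_of_pos hR0, div_mul_cancel₀ _ hn.ne'])
      rw [map_smul, map_smul, smul_eq_mul, div_mul_eq_mul_div, div_lt_iff₀ hn] at this
      rw [div_mul_eq_mul_div, le_div_iff₀ hR0]
      linarith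
    have hh : ‖h‖ ≤ u / R := by
      refine h.opNorm_le_bound (by positivity) fun x => ?_
      refine hι.induction_on x (isClosed_le (by fun_prop) (by fun_prop)) fun v => ?_
      rw [Real.norm_eq_abs, abs_le]
      have := hle (-v)
      rw [map_neg, map_neg, norm_neg] at this
      exact ⟨by linarith, hle v⟩
    have h3 : ξ h ≤ ‖ξ‖ * (u / R) :=
      ((le_abs_self _).trans (ξ.le_opNorm h)).trans (by gcongr)
    have h4 : ‖ξ‖ * (u / R) ≤ u := by
      rw [mul_div_assoc', div_le_iff₀ hR0, hR]
      nlinarith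
    linarith [hFy ▸ h2]
  obtain ⟨_, ⟨v, hv, rfl⟩, hd⟩ := Metric.mem_closure_iff.1 hy 1 one_pos
  refine ⟨v, hv, fun f hf => ?_⟩
  have := (dist_le_pi_dist y (T v) ⟨f, hf⟩).trans hd.le
  simpa [Real.dist_eq, y, hT] using this

/-- A Milman–Pettis theorem: a Banach space is reflexive if some dense subspace carries a
nonnegative function that is bounded on bounded sets and uniformly convex on its sublevel sets. -/
theorem isReflexive_of_uniformlyConvex [CompleteSpace X] (ι : V →ₗ[ℝ] X) (hι : DenseRange ι)
    (ρ : V → ℝ) (hρ0 : ∀ v, 0 ≤ ρ v) (hρb : ∀ R, ∃ M, ∀ v, ‖ι v‖ ≤ R → ρ v ≤ M)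
    (hρc : ∀ M, ∀ ε > 0, ∃ δ > 0, ∀ u v, ρ u ≤ M → ρ v ≤ M →
      (ρ u + ρ v) / 2 - δ ≤ ρ ((1 / 2 : ℝ) • (u + v)) → ‖ι u - ι v‖ ≤ ε) :
    IsReflexive X := by
  classical
  intro ξ
  let S : Finset (StrongDual ℝ X) → Set V := fun A => {v | ∀ f ∈ A, |ξ f - f (ι v)| ≤ 1}
  have hSmono : ∀ {A B}, A ⊆ B → S B ⊆ S A := fun h v hv f hf => hv f (h hf)
  have hSmid : ∀ {A u v}, u ∈ S A → v ∈ S A → (1 / 2 : ℝ) • (u + v) ∈ S A := by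
    intro A u v hu hv f hf
    have h1 := abs_le.1 (hu f hf)
    have h2 := abs_le.1 (hv f hf)
    rw [map_smul, map_smul, map_add, map_add, smul_eq_mul, abs_le]
    constructor <;> linarith [h1.1, h1.2, h2.1, h2.2]
  obtain ⟨M, hM⟩ := hρb (‖ξ‖ + 1)
  have hSM : ∀ A, ∃ v ∈ S A, ρ v ≤ M := fun A =>
    let ⟨v, h1, h2⟩ := exists_approx_bidual ι hι ξ A
    ⟨v, h2, hM v h1⟩
  let Q : Set ℝ := {t | ∃ A, ∀ v ∈ S A, t ≤ ρ v}
  have hQne : Q.Nonempty := ⟨0, ∅, fun v _ => hρ0 v⟩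
  have hQb : BddAbove Q := by
    refine ⟨M, ?_⟩
    rintro t ⟨A, hA⟩
    obtain ⟨v, h1, h2⟩ := hSM A
    exact (hA v h1).trans h2
  -- The limit, along growing `A`, of the infimum of `ρ` on the slice `S A`. Slices are stable under
  -- midpoints, so near-minimisers have midpoints of almost the same `ρ`.
  set m := sSup Q
  have hlow : ∀ δ > 0, ∃ A, ∀ v ∈ S A, m - δ ≤ ρ v := by
    intro δ hδ
    obtain ⟨t, ⟨A, hA⟩, ht⟩ := exists_lt_of_lt_csSup hQne (sub_lt_self m hδ)
    exact ⟨A, fun v hv => ht.le.trans (hA v hv)⟩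
  have hup : ∀ A, ∀ δ > 0, ∃ v ∈ S A, ρ v < m + δ := by
    intro A δ hδ
    by_contra! h
    linarith [le_csSup hQb (show m + δ ∈ Q from ⟨A, h⟩)]
  have hpos : ∀ n : ℕ, (0 : ℝ) < 1 / ((n : ℝ) + 1) := fun n => Nat.one_div_pos_of_nat
  choose x hxS hxρ using fun i : Finset (StrongDual ℝ X) × ℕ => hup i.1 _ (hpos i.2)
  have hcauchy : CauchySeq fun i => ι (x i) := by
    rw [Metric.cauchySeq_iff']
    intro ε hε
    obtain ⟨δ, hδ, hc⟩ := hρc (m + 1) (ε / 2) (by positivity)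
    obtain ⟨A, hA⟩ := hlow (δ / 2) (by positivity)
    obtain ⟨k, hk⟩ := exists_nat_one_div_lt (show 0 < δ / 2 by positivity)
    refine ⟨(A, k), fun i hi => ?_⟩
    have hone : ∀ n : ℕ, 1 / ((n : ℝ) + 1) ≤ 1 := fun n => by
      rw [div_le_one (by positivity)]
      linarith [Nat.cast_nonneg (α := ℝ) n]
    have hik : 1 / ((i.2 : ℝ) + 1) ≤ 1 / ((k : ℝ) + 1) :=
      Nat.one_div_le_one_div hi.2
    have h1 := hA _ (hSmid (hSmono hi.1 (hxS i)) (hxS (A, k)))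
    have h2 := hxρ i
    have h3 := hxρ (A, k)
    simp only at h3
    rw [dist_eq_norm]
    refine (hc _ _ ?_ ?_ ?_).trans_lt (half_lt_self hε)
    · linarith [hone i.2]
    · linarith [hone k]
    · linarith
  obtain ⟨z, hz⟩ := cauchySeq_tendsto_of_complete hcauchy
  refine ⟨z, ?_⟩
  ext f
  rw [NormedSpace.dual_def]
  -- The fixed tolerance `1` suffices because the slices also test the multiples `k • f`.
  have key : ∀ k : ℕ, (k : ℝ) * |ξ f - f z| ≤ 1 := by
    intro k
    have hlim : Tendsto (fun i => |ξ ((k : ℝ) • f) - ((k : ℝ) • f) (ι (x i))|) atTop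
        (𝓝 |ξ ((k : ℝ) • f) - ((k : ℝ) • f) z|) :=
      (tendsto_const_nhds.sub ((((k : ℝ) • f).continuous.tendsto z).comp hz)).abs
    have hle := le_of_tendsto hlim (b := 1) (by
      filter_upwards [eventually_ge_atTop (({(k : ℝ) • f} : Finset _), 0)] with i hi
      exact hxS i _ (hi.1 (Finset.mem_singleton_self _)))
    rw [map_smul, smul_apply, smul_eq_mul, smul_eq_mul, ← mul_sub, abs_mul,
      Nat.abs_cast] at hle
    exact hle
  by_contra hne
  have hpos' : 0 < |ξ f - f z| := abs_pos.2 (sub_ne_zero.2 (Ne.symm hne))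
  obtain ⟨k, hk⟩ := exists_nat_gt (1 / |ξ f - f z|)
  rw [div_lt_iff₀ hpos'] at hk
  linarith [key k]

end Reflexivity

/-- A space is separable if it maps to a second countable space by a map whose inverse is uniformly
continuous on the image. -/
lemma separableSpace_of_dist_lt {α β : Type*} [PseudoMetricSpace α] [PseudoMetricSpace β]
    [SecondCountableTopology β] (f : α → β)
    (hf : ∀ ε > 0, ∃ δ > 0, ∀ x y, dist (f x) (f y) < δ → dist x y < ε) : SeparableSpace α := by
  obtain ⟨s, hs, hd⟩ := exists_countable_dense (Set.range f)
  -- The countable dense set is taken in the image rather than in `β`, so that its points have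
  -- preimages.
  choose g hg using fun y : Set.range f => y.2
  refine ⟨g '' s, hs.image g, fun x => Metric.mem_closure_iff.2 fun ε hε => ?_⟩
  obtain ⟨δ, hδ, h⟩ := hf ε hε
  obtain ⟨y, hy, hxy⟩ := Metric.dense_iff.1 hd ⟨f x, x, rfl⟩ δ hδ
  refine ⟨g y, Set.mem_image_of_mem g hxy, h _ _ ?_⟩
  rw [hg y, dist_comm]
  exact hy

/-! ### Pointwise inequalities for powers of the norm -/

section Pointwise

variable {F : Type*} [NormedAddCommGroup F] [InnerProductSpace ℝ F]

lemma norm_half_smul_add_rpow_le {a b : F} {p : ℝ} (hp : 1 ≤ p) :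
    ‖(1 / 2 : ℝ) • (a + b)‖ ^ p ≤ (‖a‖ ^ p + ‖b‖ ^ p) / 2 := by
  have h1 : ‖(1 / 2 : ℝ) • (a + b)‖ ≤ (1 / 2) * ‖a‖ + (1 / 2) * ‖b‖ := by
    rw [norm_smul, Real.norm_of_nonneg (by norm_num)]
    linarith [norm_add_le a b]
  have h2 := (convexOn_rpow hp).2 (Set.mem_Ici.mpr (norm_nonneg a))
    (Set.mem_Ici.mpr (norm_nonneg b)) (by norm_num : (0 : ℝ) ≤ 1 / 2)
    (by norm_num : (0 : ℝ) ≤ 1 / 2) (by norm_num)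
  have h3 := Real.rpow_le_rpow (norm_nonneg _) h1 (by linarith : 0 ≤ p)
  simp only [smul_eq_mul] at h2
  linarith

/-- For equal norms, strictness comes from strict convexity of the inner product norm; for different
norms, from that of `t ↦ t ^ p`. -/
lemma norm_half_smul_add_rpow_lt {a b : F} {p : ℝ} (hp : 1 < p) (hab : a ≠ b) :
    ‖(1 / 2 : ℝ) • (a + b)‖ ^ p < (‖a‖ ^ p + ‖b‖ ^ p) / 2 := by
  by_cases h : ‖a‖ = ‖b‖
  · have h1 := (norm_midpoint_lt_iff h).2 hab
    have h2 := Real.rpow_lt_rpow (norm_nonneg _) h1 (by linarith : 0 < p)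
    rw [← h]
    linarith
  · have h1 : ‖(1 / 2 : ℝ) • (a + b)‖ ≤ (1 / 2) * ‖a‖ + (1 / 2) * ‖b‖ := by
      rw [norm_smul, Real.norm_of_nonneg (by norm_num)]
      linarith [norm_add_le a b]
    have h2 := (strictConvexOn_rpow hp).2 (Set.mem_Ici.mpr (norm_nonneg a))
      (Set.mem_Ici.mpr (norm_nonneg b)) h (by norm_num : (0 : ℝ) < 1 / 2)
      (by norm_num : (0 : ℝ) < 1 / 2) (by norm_num)
    have h3 := Real.rpow_le_rpow (norm_nonneg _) h1 (by linarith : 0 ≤ p)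
    simp only [smul_eq_mul] at h2
    linarith

/-- Uniform convexity of `‖·‖ ^ p`, uniformly for `p` in a compact subinterval of `(1, ∞)`, on
pairs of vectors in the unit ball, one of them a unit vector. -/
lemma exists_rpow_convexity_defect_unit [FiniteDimensional ℝ F] {r P η : ℝ} (hr : 1 < r)
    (hη : 0 < η) :
    ∃ C : ℝ, 0 ≤ C ∧ ∀ p ∈ Set.Icc r P, ∀ a b : F, ‖a‖ ≤ 1 → ‖b‖ ≤ 1 → 1 ≤ max ‖a‖ ‖b‖ →
      ‖(1 / 2 : ℝ) • (a - b)‖ ^ p + C * ‖(1 / 2 : ℝ) • (a + b)‖ ^ p ≤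
        (η + C) * ((‖a‖ ^ p + ‖b‖ ^ p) / 2) := by
  let K₀ : Set (F × F × ℝ) := Metric.closedBall 0 1 ×ˢ Metric.closedBall 0 1 ×ˢ Set.Icc r P
  have hK₀ : IsCompact K₀ :=
    (isCompact_closedBall _ _).prod ((isCompact_closedBall _ _).prod isCompact_Icc)
  have hmem : ∀ z ∈ K₀, ‖z.1‖ ≤ 1 ∧ ‖z.2.1‖ ≤ 1 ∧ r ≤ z.2.2 ∧ z.2.2 ≤ P := by
    rintro ⟨a, b, p⟩ ⟨h1, h2, h3⟩
    exact ⟨by simpa using h1, by simpa using h2, h3.1, h3.2⟩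
  have hcont : ∀ g : F × F × ℝ → F, Continuous g →
      ContinuousOn (fun z => ‖g z‖ ^ z.2.2) K₀ := by
    intro g hg
    refine ContinuousOn.rpow hg.norm.continuousOn (by fun_prop) fun z hz => Or.inr ?_
    linarith [(hmem z hz).2.2.1]
  let S : F × F × ℝ → ℝ := fun z => (‖z.1‖ ^ z.2.2 + ‖z.2.1‖ ^ z.2.2) / 2
  have hS : ContinuousOn S K₀ :=
    ((hcont _ continuous_fst).add (hcont (fun z => z.2.1) (by fun_prop))).div_const 2
  have hD := hcont (fun z => (1 / 2 : ℝ) • (z.1 - z.2.1)) (by fun_prop)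
  have hA := hcont (fun z => (1 / 2 : ℝ) • (z.1 + z.2.1)) (by fun_prop)
  -- Off `K`, midpoint convexity alone gives the claim. On the compact set `K` one has `a ≠ b`, so
  -- the convexity defect has a positive minimum `c`; then `C = 1 / c` makes `C` times the defect at
  -- least `1`, which dominates the difference term.
  let K : Set (F × F × ℝ) := {z ∈ K₀ | 1 ≤ max ‖z.1‖ ‖z.2.1‖ ∧
    η * S z ≤ ‖(1 / 2 : ℝ) • (z.1 - z.2.1)‖ ^ z.2.2}
  have hK : IsCompact K := by
    refine hK₀.of_isClosed_subset ?_ (Set.sep_subset _ _)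
    have e : K = {z ∈ K₀ | 1 ≤ max ‖z.1‖ ‖z.2.1‖} ∩
        {z ∈ K₀ | η * S z ≤ ‖(1 / 2 : ℝ) • (z.1 - z.2.1)‖ ^ z.2.2} := by
      ext z; simp only [K, Set.mem_ofPred_eq, Set.mem_inter_iff]; tauto
    rw [e]
    exact (hK₀.isClosed.isClosed_le continuousOn_const (by fun_prop)).inter
      (hK₀.isClosed.isClosed_le (continuousOn_const.mul hS) hD)
  have hpos : ∀ z ∈ K, 0 < S z - ‖(1 / 2 : ℝ) • (z.1 + z.2.1)‖ ^ z.2.2 := by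
    rintro ⟨a, b, p⟩ ⟨hz, h1, h2⟩
    obtain ⟨-, -, hp, -⟩ := hmem _ hz
    simp only [S] at h1 h2 hp ⊢
    refine sub_pos.2 (norm_half_smul_add_rpow_lt (hr.trans_le hp) ?_)
    rintro rfl
    rw [max_self] at h1
    have := Real.one_le_rpow h1 (by linarith : 0 ≤ p)
    rw [sub_self, smul_zero, norm_zero, Real.zero_rpow (by linarith)] at h2
    nlinarith
  have hc : ∃ c > 0, ∀ z ∈ K, c ≤ S z - ‖(1 / 2 : ℝ) • (z.1 + z.2.1)‖ ^ z.2.2 := by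
    rcases K.eq_empty_or_nonempty with h | h
    · exact ⟨1, one_pos, by simp [h]⟩
    · obtain ⟨z, hz, hmin⟩ := hK.exists_isMinOn h ((hS.sub hA).mono (Set.sep_subset _ _))
      exact ⟨_, hpos z hz, fun w hw => hmin hw⟩
  obtain ⟨c, hc0, hc⟩ := hc
  refine ⟨1 / c, by positivity, fun p hp a b ha hb hm => ?_⟩
  have hp1 : 1 ≤ p := hr.le.trans hp.1
  have hmid := norm_half_smul_add_rpow_le (a := a) (b := b) hp1
  have hC : 0 < 1 / c := by positivity
  by_cases h : η * ((‖a‖ ^ p + ‖b‖ ^ p) / 2) ≤ ‖(1 / 2 : ℝ) • (a - b)‖ ^ p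
  · have h1 := hc (a, b, p) ⟨⟨by simpa using ha, by simpa using hb, hp⟩, hm, h⟩
    simp only [S] at h1
    have h2 : ‖(1 / 2 : ℝ) • (a - b)‖ ^ p ≤ 1 := by
      refine Real.rpow_le_one (norm_nonneg _) ?_ (by linarith)
      rw [norm_smul, Real.norm_of_nonneg (by norm_num)]
      linarith [norm_sub_le a b]
    have h3 : 1 ≤ 1 / c * ((‖a‖ ^ p + ‖b‖ ^ p) / 2 - ‖(1 / 2 : ℝ) • (a + b)‖ ^ p) := by
      rw [div_mul_eq_mul_div, one_mul, le_div_iff₀ hc0]; linarith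
    have h4 : 0 ≤ η * ((‖a‖ ^ p + ‖b‖ ^ p) / 2) := by positivity
    linarith
  · linarith [mul_le_mul_of_nonneg_left hmid hC.le]

/-- Both sides are homogeneous of degree `p` in `(a, b)`, so dividing by `max ‖a‖ ‖b‖` reduces to
the normalised case. -/
lemma exists_rpow_convexity_defect [FiniteDimensional ℝ F] {r P η : ℝ} (hr : 1 < r)
    (hη : 0 < η) :
    ∃ C : ℝ, 0 ≤ C ∧ ∀ p ∈ Set.Icc r P, ∀ a b : F,
      ‖(1 / 2 : ℝ) • (a - b)‖ ^ p + C * ‖(1 / 2 : ℝ) • (a + b)‖ ^ p ≤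
        (η + C) * ((‖a‖ ^ p + ‖b‖ ^ p) / 2) := by
  obtain ⟨C, hC, h⟩ := exists_rpow_convexity_defect_unit (F := F) (P := P) hr hη
  refine ⟨C, hC, fun p hp a b => ?_⟩
  have hp0 : p ≠ 0 := by linarith [hp.1]
  set t := max ‖a‖ ‖b‖ with ht
  rcases (le_max_of_le_left (norm_nonneg a) : 0 ≤ t).eq_or_lt with h0 | h0
  · have ha : a = 0 := norm_le_zero_iff.1 (h0 ▸ le_max_left _ _)
    have hb : b = 0 := norm_le_zero_iff.1 (h0 ▸ le_max_right _ _)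
    simp [ha, hb, Real.zero_rpow hp0]
  have hn : ∀ z : F, ‖t⁻¹ • z‖ = t⁻¹ * ‖z‖ := fun z => by
    rw [norm_smul, Real.norm_of_nonneg (by positivity)]
  have hscale : ∀ z : F, ‖t⁻¹ • z‖ ^ p = (t⁻¹) ^ p * ‖z‖ ^ p := fun z => by
    rw [hn, Real.mul_rpow (by positivity) (norm_nonneg _)]
  have key := h p hp (t⁻¹ • a) (t⁻¹ • b)
    (by rw [hn, inv_mul_le_one₀ h0]; exact le_max_left _ _)
    (by rw [hn, inv_mul_le_one₀ h0]; exact le_max_right _ _)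
    (by rw [hn, hn, ← mul_max_of_nonneg _ _ (by positivity), ← ht, inv_mul_cancel₀ h0.ne'])
  rw [← smul_sub, ← smul_add, smul_comm _ t⁻¹, smul_comm _ t⁻¹, hscale, hscale, hscale,
    hscale] at key
  have hT : 0 < (t⁻¹) ^ p := by positivity
  refine le_of_mul_le_mul_left ?_ hT
  linarith

/-- The inverse of the Mazur map `z ↦ ‖z‖ ^ (p - 1) • z` is Hölder continuous. -/
lemma norm_sub_rpow_le_mazur {p : ℝ} (hp : 1 ≤ p) (a b : F) :
    ‖a - b‖ ^ p ≤ 2 ^ p * ‖‖a‖ ^ (p - 1) • a - ‖b‖ ^ (p - 1) • b‖ := by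
  set q := p - 1 with hq
  have hq0 : 0 ≤ q := by linarith
  set A := ‖a‖ ^ q
  set B := ‖b‖ ^ q
  have hA : 0 ≤ A := by positivity
  have hB : 0 ≤ B := by positivity
  set N := ‖A • a - B • b‖
  have hN : 0 ≤ N := norm_nonneg _
  rcases (norm_nonneg (a - b)).eq_or_lt with h0 | h0
  · rw [← h0, Real.zero_rpow (by linarith)]
    positivity
  have hmono : 0 ≤ (A - B) * (‖a‖ ^ 2 - ‖b‖ ^ 2) := by
    rcases le_total ‖a‖ ‖b‖ with h | h
    · exact mul_nonneg_of_nonpos_of_nonpos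
        (sub_nonpos.2 (Real.rpow_le_rpow (norm_nonneg _) h hq0))
        (sub_nonpos.2 (pow_le_pow_left₀ (norm_nonneg _) h 2))
    · exact mul_nonneg (sub_nonneg.2 (Real.rpow_le_rpow (norm_nonneg _) h hq0))
        (sub_nonneg.2 (pow_le_pow_left₀ (norm_nonneg _) h 2))
  -- Monotonicity of the Mazur map: the last term is nonnegative because `t ^ q` and `t ^ 2`
  -- increase together. Cauchy–Schwarz then bounds `(A + B) / 2 * ‖a - b‖` by `N`.
  have hinner : inner ℝ (A • a - B • b) (a - b) =
      (A + B) / 2 * ‖a - b‖ ^ 2 + (A - B) * (‖a‖ ^ 2 - ‖b‖ ^ 2) / 2 := by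
    rw [norm_sub_sq_real, inner_sub_left, inner_sub_right, inner_sub_right, real_inner_smul_left,
      real_inner_smul_left, real_inner_smul_left, real_inner_smul_left,
      real_inner_self_eq_norm_sq, real_inner_self_eq_norm_sq, real_inner_comm a b]
    ring
  have hcs := real_inner_le_norm (A • a - B • b) (a - b)
  have h1 : (A + B) / 2 * ‖a - b‖ ≤ N := by
    refine le_of_mul_le_mul_right ?_ h0
    calc (A + B) / 2 * ‖a - b‖ * ‖a - b‖ = (A + B) / 2 * ‖a - b‖ ^ 2 := by ring
      _ ≤ N * ‖a - b‖ := by linarith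
  have h2 : ‖a - b‖ ^ q ≤ 2 ^ q * (A + B) := by
    have h3 : ‖a - b‖ ≤ 2 * max ‖a‖ ‖b‖ :=
      (norm_sub_le a b).trans (by linarith [le_max_left ‖a‖ ‖b‖, le_max_right ‖a‖ ‖b‖])
    have h4 := Real.rpow_le_rpow (norm_nonneg _) h3 hq0
    rw [Real.mul_rpow (by norm_num) (le_max_of_le_left (norm_nonneg a))] at h4
    refine h4.trans (mul_le_mul_of_nonneg_left ?_ (by positivity))
    rcases max_choice ‖a‖ ‖b‖ with h | h <;> rw [h] <;> simp only [A, B] at * <;> linarith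
  have e1 : ‖a - b‖ ^ p = ‖a - b‖ ^ q * ‖a - b‖ := by
    rw [← Real.rpow_add_one h0.ne', hq, sub_add_cancel]
  have e2 : (2 : ℝ) ^ p = 2 ^ q * 2 := by
    rw [← Real.rpow_add_one (by norm_num), hq, sub_add_cancel]
  rw [e1, e2]
  have h5 : (0 : ℝ) < 2 ^ q := by positivity
  calc ‖a - b‖ ^ q * ‖a - b‖ ≤ 2 ^ q * (A + B) * ‖a - b‖ := by gcongr
    _ = 2 ^ q * (2 * ((A + B) / 2 * ‖a - b‖)) := by ring
    _ ≤ 2 ^ q * (2 * N) := by gcongr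
    _ = 2 ^ q * 2 * N := by ring

end Pointwise

/-! ### Comparison of modular and Luxemburg norm -/

section VariableLebesgue

variable {d : ℕ} {Ω : Opens (EuclideanSpace ℝ (Fin d))} (p : BoundedExponent Ω) (σ : Weight d)

/-- The essential supremum `p⁺` as a real number. -/
def BoundedExponent.upper : ℝ :=
  (essSup (fun x => ENNReal.ofReal (p.toFun x))
    (volume.restrict (Ω : Set (EuclideanSpace ℝ (Fin d))))).toReal

/-- The Lebesgue measure on `Ω`. -/
abbrev domainMeasure (Ω : Opens (EuclideanSpace ℝ (Fin d))) :
    Measure (EuclideanSpace ℝ (Fin d)) :=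
  volume.restrict (Ω : Set (EuclideanSpace ℝ (Fin d)))

lemma BoundedExponent.ae_one_le : ∀ᵐ x ∂domainMeasure Ω, 1 ≤ p.toFun x := by
  filter_upwards [ae_restrict_mem Ω.isOpen.measurableSet] with x hx using p.one_le x hx

lemma BoundedExponent.ae_le_upper : ∀ᵐ x ∂domainMeasure Ω, p.toFun x ≤ p.upper := by
  filter_upwards [ae_le_essSup (f := fun x => ENNReal.ofReal (p.toFun x)) (μ := domainMeasure Ω)]
    with x hx
  exact (ENNReal.ofReal_le_iff_le_toReal p.essSup_lt_top.ne).1 hx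

/-- A real number strictly between `1` and `p⁻` is used since `p⁻` itself may be `∞` (for empty
`Ω`). -/
lemma BoundedExponent.exists_ae_le (hp : 1 < p.lower) :
    ∃ r : ℝ, 1 < r ∧ ∀ᵐ x ∂domainMeasure Ω, r ≤ p.toFun x := by
  obtain ⟨r, h1, h2⟩ := ENNReal.lt_iff_exists_real_btwn.1 hp
  obtain ⟨h2, h3⟩ := h2
  refine ⟨r, ?_, ?_⟩
  · simpa using h2
  · filter_upwards [ae_essInf_le (f := fun x => ENNReal.ofReal (p.toFun x))
      (μ := domainMeasure Ω), p.ae_one_le] with x hx hx1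
    exact (ENNReal.ofReal_le_ofReal_iff (by linarith)).1 (h3.le.trans hx)

variable {F : Type*} [NormedAddCommGroup F]

lemma modular_mono {u v : EuclideanSpace ℝ (Fin d) → F} (h : ∀ x, ‖u x‖ ≤ ‖v x‖) :
    modular p σ u ≤ modular p σ v := by
  refine lintegral_mono_ae ?_
  filter_upwards [p.ae_one_le, ae_restrict_of_ae σ.ae_pos] with x hx hσ
  exact ENNReal.ofReal_le_ofReal (mul_le_mul_of_nonneg_right
    (Real.rpow_le_rpow (norm_nonneg _) (h x) (by linarith)) hσ.le)

lemma Weight.aemeasurable_restrict : AEMeasurable σ.toFun (domainMeasure Ω) :=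
  σ.locallyIntegrable.aestronglyMeasurable.aemeasurable.restrict

lemma aemeasurable_modular_integrand {u : EuclideanSpace ℝ (Fin d) → F}
    (hu : AEStronglyMeasurable u (domainMeasure Ω)) :
    AEMeasurable (fun x => ENNReal.ofReal (‖u x‖ ^ p.toFun x * σ.toFun x)) (domainMeasure Ω) :=
  ((hu.norm.aemeasurable.pow p.aemeasurable).mul σ.aemeasurable_restrict).ennreal_ofReal

variable [NormedSpace ℝ F]

lemma modular_smul_le {c : ℝ} (hc : 1 ≤ c) (u : EuclideanSpace ℝ (Fin d) → F) :
    modular p σ (fun x => c • u x) ≤ ENNReal.ofReal (c ^ p.upper) * modular p σ u := by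
  unfold modular
  rw [← lintegral_const_mul' _ _ ENNReal.ofReal_ne_top]
  refine lintegral_mono_ae ?_
  filter_upwards [p.ae_le_upper, ae_restrict_of_ae σ.ae_pos] with x hx hσ
  rw [← ENNReal.ofReal_mul (by positivity), norm_smul, Real.norm_of_nonneg (by linarith),
    Real.mul_rpow (by linarith) (norm_nonneg _), mul_assoc]
  refine ENNReal.ofReal_le_ofReal (mul_le_mul_of_nonneg_right
    (Real.rpow_le_rpow_of_exponent_le hc hx) (by positivity))

lemma modular_le_of_luxNorm_lt {u : EuclideanSpace ℝ (Fin d) → F} {R : ℝ} (hR : 1 ≤ R)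
    (h : luxNorm p σ u < ENNReal.ofReal R) : modular p σ u ≤ ENNReal.ofReal (R ^ p.upper) := by
  simp only [luxNorm, iInf_lt_iff] at h
  obtain ⟨s, ⟨hs0, hs⟩, hsR⟩ := h
  have hsR' : s < R := (ENNReal.ofReal_lt_ofReal_iff (by linarith)).1 hsR
  have e : u = fun x => R • (R⁻¹ • u x) := by
    ext x; rw [smul_inv_smul₀ (by linarith)]
  rw [e]
  refine (modular_smul_le p σ hR _).trans ?_
  refine mul_le_of_le_one_right bot_le ((modular_mono p σ fun x => ?_).trans hs)
  rw [norm_smul, norm_smul, norm_inv, norm_inv, Real.norm_of_nonneg (by linarith : 0 ≤ R),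
    Real.norm_of_nonneg hs0.le]
  gcongr

lemma modular_lt_top_of_luxNorm {u : EuclideanSpace ℝ (Fin d) → F} (h : luxNorm p σ u < ⊤) :
    modular p σ u < ⊤ := by
  refine (modular_le_of_luxNorm_lt p σ (R := (luxNorm p σ u).toReal + 1) (by simp) ?_).trans_lt
    ENNReal.ofReal_lt_top
  rw [ENNReal.lt_ofReal_iff_toReal_lt h.ne]
  linarith

/-- Scaling by `ε⁻¹ ≥ 1` multiplies the modular by at most `ε⁻¹ ^ p⁺`, which the assumed bound
cancels. -/
lemma luxNorm_le_of_modular_le {u : EuclideanSpace ℝ (Fin d) → F} {ε : ℝ} (h0 : 0 < ε)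
    (h1 : ε ≤ 1) (h : modular p σ u ≤ ENNReal.ofReal (ε ^ p.upper)) :
    luxNorm p σ u ≤ ENNReal.ofReal ε := by
  refine iInf₂_le ε ⟨h0, (modular_smul_le p σ ((one_le_inv₀ h0).2 h1) u).trans ?_⟩
  calc ENNReal.ofReal (ε⁻¹ ^ p.upper) * modular p σ u
      ≤ ENNReal.ofReal (ε⁻¹ ^ p.upper) * ENNReal.ofReal (ε ^ p.upper) := by gcongr
    _ = 1 := by
      rw [← ENNReal.ofReal_mul (by positivity), ← Real.mul_rpow (by positivity) h0.le,
        inv_mul_cancel₀ h0.ne', Real.one_rpow, ENNReal.ofReal_one]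

end VariableLebesgue

/-! ### Uniform convexity of the modular and the Mazur map into `L¹` -/

section InnerProduct

variable {d : ℕ} {Ω : Opens (EuclideanSpace ℝ (Fin d))} (p : BoundedExponent Ω) (σ : Weight d)
  {F : Type*} [NormedAddCommGroup F] [InnerProductSpace ℝ F]

/-- Uniform convexity of the modular. -/
lemma exists_modular_convexity_defect [FiniteDimensional ℝ F] (hp : 1 < p.lower) {η : ℝ}
    (hη : 0 < η) :
    ∃ C : ℝ, 1 ≤ C ∧ ∀ K ≥ C, ∀ u v : EuclideanSpace ℝ (Fin d) → F,
      AEStronglyMeasurable u (domainMeasure Ω) → AEStronglyMeasurable v (domainMeasure Ω) →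
      modular p σ u < ⊤ → modular p σ v < ⊤ →
      modular p σ (fun x => (1 / 2 : ℝ) • (u x - v x)) < ⊤ ∧
      (modular p σ (fun x => (1 / 2 : ℝ) • (u x - v x))).toReal +
        K * (modular p σ (fun x => (1 / 2 : ℝ) • (u x + v x))).toReal ≤
      (η + K) * (((modular p σ u).toReal + (modular p σ v).toReal) / 2) := by
  obtain ⟨r, hr1, hr⟩ := p.exists_ae_le hp
  obtain ⟨C, hC, h⟩ := exists_rpow_convexity_defect (F := F) (P := p.upper) hr1 hη
  refine ⟨C + 1, by linarith, fun K hK u v hu hv hu' hv' => ?_⟩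
  have hK0 : 0 ≤ K := by linarith
  have key : modular p σ (fun x => (1 / 2 : ℝ) • (u x - v x)) + ENNReal.ofReal K *
      modular p σ (fun x => (1 / 2 : ℝ) • (u x + v x)) ≤
      ENNReal.ofReal ((η + K) / 2) * (modular p σ u + modular p σ v) := by
    have hd : AEStronglyMeasurable (fun x => (1 / 2 : ℝ) • (u x - v x)) (domainMeasure Ω) :=
      (hu.sub hv).const_smul _
    unfold modular
    rw [← lintegral_const_mul' _ _ ENNReal.ofReal_ne_top,
      ← lintegral_add_left' (aemeasurable_modular_integrand p σ hd),
      ← lintegral_add_left' (aemeasurable_modular_integrand p σ hu),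
      ← lintegral_const_mul' _ _ ENNReal.ofReal_ne_top]
    refine lintegral_mono_ae ?_
    filter_upwards [hr, p.ae_le_upper, p.ae_one_le, ae_restrict_of_ae σ.ae_pos]
      with x hx1 hx2 hx3 hσ
    have h1 := h _ ⟨hx1, hx2⟩ (u x) (v x)
    -- Adding `K - C` times midpoint convexity raises `C` to any larger `K`, so one constant can
    -- serve both `u` and `∇u`.
    have h2 := mul_le_mul_of_nonneg_left (norm_half_smul_add_rpow_le (a := u x) (b := v x) hx3)
      (by linarith : 0 ≤ K - C)
    rw [← ENNReal.ofReal_mul hK0, ← ENNReal.ofReal_add (by positivity) (by positivity),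
      ← ENNReal.ofReal_add (by positivity) (by positivity), ← ENNReal.ofReal_mul (by positivity)]
    refine ENNReal.ofReal_le_ofReal ?_
    have h3 := mul_le_mul_of_nonneg_right (add_le_add h1 h2) hσ.le
    linarith
  have htop := key.trans_lt (ENNReal.mul_lt_top ENNReal.ofReal_lt_top
    (ENNReal.add_lt_top.2 ⟨hu', hv'⟩))
  have hd := (ENNReal.add_lt_top.1 htop).1
  refine ⟨hd, ?_⟩
  have h1 := ENNReal.toReal_mono (ENNReal.mul_lt_top ENNReal.ofReal_lt_top
    (ENNReal.add_lt_top.2 ⟨hu', hv'⟩)).ne key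
  rw [ENNReal.toReal_add hd.ne (ENNReal.add_lt_top.1 htop).2.ne, ENNReal.toReal_mul,
    ENNReal.toReal_mul, ENNReal.toReal_add hu'.ne hv'.ne, ENNReal.toReal_ofReal hK0,
    ENNReal.toReal_ofReal (by positivity)] at h1
  linarith

/-- The weighted Mazur map, sending `u` to `σ |u| ^ (p - 1) u`. -/
def mazur (u : EuclideanSpace ℝ (Fin d) → F) : EuclideanSpace ℝ (Fin d) → F :=
  fun x => σ.toFun x • ‖u x‖ ^ (p.toFun x - 1) • u x

/-- The norm of the Mazur image equals the integrand of the modular almost everywhere. -/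
lemma memLp_mazur {u : EuclideanSpace ℝ (Fin d) → F}
    (hu : AEStronglyMeasurable u (domainMeasure Ω)) (h : modular p σ u < ⊤) :
    MemLp (mazur p σ u) 1 (domainMeasure Ω) := by
  refine ⟨σ.aemeasurable_restrict.aestronglyMeasurable.smul
    ((hu.norm.aemeasurable.pow (p.aemeasurable.sub_const 1)).aestronglyMeasurable.smul hu), ?_⟩
  rw [eLpNorm_one_eq_lintegral_enorm]
  refine lt_of_le_of_lt (lintegral_mono_ae ?_) h
  filter_upwards [p.ae_one_le, ae_restrict_of_ae σ.ae_pos] with x hx hσ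
  rw [← ofReal_norm]
  refine ENNReal.ofReal_le_ofReal (le_of_eq ?_)
  rw [mazur, norm_smul, norm_smul, Real.norm_of_nonneg hσ.le,
    Real.norm_of_nonneg (by positivity)]
  rcases (norm_nonneg (u x)).eq_or_lt with h0 | h0
  · rw [← h0, Real.zero_rpow (by linarith : p.toFun x ≠ 0)]; simp
  · rw [← Real.rpow_add_one h0.ne', sub_add_cancel, mul_comm]

lemma modular_sub_le_mazur (u v : EuclideanSpace ℝ (Fin d) → F) :
    modular p σ (fun x => u x - v x) ≤ ENNReal.ofReal (2 ^ p.upper) *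
      eLpNorm (mazur p σ u - mazur p σ v) 1 (domainMeasure Ω) := by
  rw [eLpNorm_one_eq_lintegral_enorm, modular, ← lintegral_const_mul' _ _ ENNReal.ofReal_ne_top]
  refine lintegral_mono_ae ?_
  filter_upwards [p.ae_le_upper, p.ae_one_le, ae_restrict_of_ae σ.ae_pos] with x hx2 hx hσ
  rw [← ofReal_norm, ← ENNReal.ofReal_mul (by positivity)]
  refine ENNReal.ofReal_le_ofReal ?_
  rw [Pi.sub_apply, mazur, mazur, ← smul_sub, norm_smul, Real.norm_of_nonneg hσ.le]
  have h1 := norm_sub_rpow_le_mazur hx (u x) (v x)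
  have h2 : (2 : ℝ) ^ p.toFun x ≤ 2 ^ p.upper :=
    Real.rpow_le_rpow_of_exponent_le (by norm_num) hx2
  calc _ ≤ (2 ^ p.upper * ‖‖u x‖ ^ (p.toFun x - 1) • u x - ‖v x‖ ^ (p.toFun x - 1) • v x‖) *
        σ.toFun x := by
        refine mul_le_mul_of_nonneg_right (h1.trans ?_) hσ.le
        gcongr
    _ = _ := by ring

/-- The modular of a difference is controlled by the distance of the Mazur images in `L¹`. -/
lemma modular_sub_le_dist {u v : EuclideanSpace ℝ (Fin d) → F}
    (hu : MemLp (mazur p σ u) 1 (domainMeasure Ω)) (hv : MemLp (mazur p σ v) 1 (domainMeasure Ω)) :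
    modular p σ (fun x => u x - v x) ≤
      ENNReal.ofReal (2 ^ p.upper * dist (hu.toLp _) (hv.toLp _)) := by
  rw [ENNReal.ofReal_mul (by positivity), ← edist_dist, Lp.edist_toLp_toLp]
  exact modular_sub_le_mazur p σ u v

end InnerProduct

/-! ### Energy, uniform convexity and separability of the smooth space -/

section Sobolev

variable {d : ℕ} {Ω : Opens (EuclideanSpace ℝ (Fin d))} {p : BoundedExponent Ω} {σ : Weight d}

namespace SmoothSpace

/-- The function underlying an element of `SmoothSpace p σ`. -/
def fn (u : SmoothSpace p σ) : EuclideanSpace ℝ (Fin d) → ℝ := u.1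

/-- The gradient of an element of `SmoothSpace p σ`. -/
def grad (u : SmoothSpace p σ) : EuclideanSpace ℝ (Fin d) → EuclideanSpace ℝ (Fin d) :=
  fun x => ∇ u.fn x

lemma contDiffOn (u : SmoothSpace p σ) :
    ContDiffOn ℝ ∞ u.fn (Ω : Set (EuclideanSpace ℝ (Fin d))) := u.2.1

lemma grad_add (u v : SmoothSpace p σ) (x : EuclideanSpace ℝ (Fin d)) (hx : x ∈ Ω) :
    (u + v).grad x = u.grad x + v.grad x :=
  gradient_add' u.contDiffOn v.contDiffOn x hx

lemma grad_smul (c : ℝ) (u : SmoothSpace p σ) (x : EuclideanSpace ℝ (Fin d)) (hx : x ∈ Ω) :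
    (c • u).grad x = c • u.grad x :=
  gradient_smul' c u.contDiffOn x hx

lemma grad_sub (u v : SmoothSpace p σ) (x : EuclideanSpace ℝ (Fin d)) (hx : x ∈ Ω) :
    (u - v).grad x = u.grad x - v.grad x := by
  have h := grad_add (u - v) v x hx
  rw [sub_add_cancel] at h
  rw [h, add_sub_cancel_right]

lemma aestronglyMeasurable_fn (u : SmoothSpace p σ) :
    AEStronglyMeasurable u.fn (domainMeasure Ω) :=
  u.contDiffOn.continuousOn.aestronglyMeasurable Ω.isOpen.measurableSet

lemma aestronglyMeasurable_grad (u : SmoothSpace p σ) :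
    AEStronglyMeasurable u.grad (domainMeasure Ω) := by
  refine ContinuousOn.aestronglyMeasurable ?_ Ω.isOpen.measurableSet
  exact (InnerProductSpace.toDual ℝ _).symm.continuous.comp_continuousOn
    (u.contDiffOn.continuousOn_fderiv_of_isOpen Ω.isOpen (by simp))

lemma luxNorm_fn_lt_top (u : SmoothSpace p σ) : luxNorm p σ u.fn < ⊤ :=
  (ENNReal.add_lt_top.1 u.2.2.2).1

lemma luxNorm_grad_lt_top (u : SmoothSpace p σ) : luxNorm p σ u.grad < ⊤ :=
  (ENNReal.add_lt_top.1 u.2.2.2).2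

lemma modular_fn_lt_top (u : SmoothSpace p σ) : modular p σ u.fn < ⊤ :=
  modular_lt_top_of_luxNorm p σ u.luxNorm_fn_lt_top

lemma modular_grad_lt_top (u : SmoothSpace p σ) : modular p σ u.grad < ⊤ :=
  modular_lt_top_of_luxNorm p σ u.luxNorm_grad_lt_top

lemma norm_eq (u : SmoothSpace p σ) :
    ‖u‖ = (luxNorm p σ u.fn).toReal + (luxNorm p σ u.grad).toReal :=
  ENNReal.toReal_add u.luxNorm_fn_lt_top.ne u.luxNorm_grad_lt_top.ne

/-- The Sobolev modular `ρ(u) + ρ(∇u)`. -/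
def energy (u : SmoothSpace p σ) : ℝ :=
  (modular p σ u.fn).toReal + (modular p σ u.grad).toReal

lemma energy_nonneg (u : SmoothSpace p σ) : 0 ≤ u.energy := by
  unfold energy; positivity

lemma energy_le {u : SmoothSpace p σ} {R : ℝ} (hR : 1 ≤ R) (hu : ‖u‖ < R) :
    u.energy ≤ 2 * R ^ p.upper := by
  have hR' : 0 ≤ R ^ p.upper := by positivity
  have key : ∀ {a b : ℝ≥0∞}, a < ⊤ → a.toReal < R →
      (a < ENNReal.ofReal R → b ≤ ENNReal.ofReal (R ^ p.upper)) → b.toReal ≤ R ^ p.upper :=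
    fun ha h hab => ENNReal.toReal_le_of_le_ofReal hR' (hab
      ((ENNReal.lt_ofReal_iff_toReal_lt ha.ne).2 h))
  rw [norm_eq] at hu
  have h1 := ENNReal.toReal_nonneg (a := luxNorm p σ u.fn)
  have h2 := ENNReal.toReal_nonneg (a := luxNorm p σ u.grad)
  have h3 := key u.luxNorm_fn_lt_top (by linarith) (modular_le_of_luxNorm_lt p σ (u := u.fn) hR)
  have h4 := key u.luxNorm_grad_lt_top (by linarith)
    (modular_le_of_luxNorm_lt p σ (u := u.grad) hR)
  unfold energy
  linarith

/-- Smallness of both modulars forces smallness of the norm. -/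
lemma norm_le_of_modular_le {u : SmoothSpace p σ} {ε : ℝ} (h0 : 0 < ε) (h1 : ε ≤ 1)
    (hf : modular p σ u.fn ≤ ENNReal.ofReal (ε ^ p.upper))
    (hg : modular p σ u.grad ≤ ENNReal.ofReal (ε ^ p.upper)) : ‖u‖ ≤ 2 * ε := by
  have h2 := ENNReal.toReal_le_of_le_ofReal h0.le (luxNorm_le_of_modular_le p σ h0 h1 hf)
  have h3 := ENNReal.toReal_le_of_le_ofReal h0.le (luxNorm_le_of_modular_le p σ h0 h1 hg)
  rw [norm_eq]
  linarith

/-- Adding the defect inequalities for functions and gradients gives, with `w = (u - v) / 2` and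
midpoint `m`, `E(w) + K E(m) ≤ (η + K) (E(u) + E(v)) / 2`. Hence `E(w) ≤ η |M| + K δ ≤ τ`, which
makes `‖w‖ ≤ 2 ε'`. -/
lemma energy_uniformlyConvex (hp : 1 < p.lower) (M ε : ℝ) (hε : 0 < ε) :
    ∃ δ > 0, ∀ u v : SmoothSpace p σ, u.energy ≤ M → v.energy ≤ M →
      (u.energy + v.energy) / 2 - δ ≤ ((1 / 2 : ℝ) • (u + v)).energy → ‖u - v‖ ≤ ε := by
  -- One factor `2` pays for the two summands of the norm, the other for the half in `w`; the cap
  -- `1` is required by `norm_le_of_modular_le`.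
  set ε' := min (ε / 4) 1
  have hε' : 0 < ε' := by positivity
  set τ := ε' ^ p.upper
  have hτ : 0 < τ := by positivity
  set η := τ / (2 * (|M| + 1))
  have hη : 0 < η := by positivity
  have hηM : η * |M| ≤ τ / 2 := by
    rw [div_mul_eq_mul_div, div_le_iff₀ (by positivity)]
    nlinarith
  obtain ⟨C₁, hC₁, h₁⟩ := exists_modular_convexity_defect p σ (F := ℝ) hp hη
  obtain ⟨C₂, -, h₂⟩ :=
    exists_modular_convexity_defect p σ (F := EuclideanSpace ℝ (Fin d)) hp hη
  set K := max C₁ C₂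
  have hK : 0 < K := by linarith [le_max_left C₁ C₂]
  refine ⟨τ / (2 * K), by positivity, fun u v hu hv huv => ?_⟩
  set m : SmoothSpace p σ := (1 / 2 : ℝ) • (u + v)
  set w : SmoothSpace p σ := (1 / 2 : ℝ) • (u - v) with hw
  obtain ⟨f₁, f₂⟩ := h₁ K (le_max_left _ _) _ _ u.aestronglyMeasurable_fn
    v.aestronglyMeasurable_fn u.modular_fn_lt_top v.modular_fn_lt_top
  obtain ⟨g₁, g₂⟩ := h₂ K (le_max_right _ _) _ _ u.aestronglyMeasurable_grad
    v.aestronglyMeasurable_grad u.modular_grad_lt_top v.modular_grad_lt_top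
  -- Linearity of the gradient is available only on `Ω`, hence the detour through `modular_congr`.
  have em : modular p σ m.grad = modular p σ fun x => (1 / 2 : ℝ) • (u.grad x + v.grad x) :=
    modular_congr p σ fun x hx => by rw [grad_smul _ _ x hx, grad_add _ _ x hx]
  have ew : modular p σ w.grad = modular p σ fun x => (1 / 2 : ℝ) • (u.grad x - v.grad x) :=
    modular_congr p σ fun x hx => by rw [grad_smul _ _ x hx, grad_sub _ _ x hx]
  rw [← em, ← ew] at g₂
  change (modular p σ w.fn).toReal + K * (modular p σ m.fn).toReal ≤ _ at f₂
  have hE : w.energy + K * m.energy ≤ (η + K) * ((u.energy + v.energy) / 2) := by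
    unfold energy
    linarith
  have hKδ : K * (τ / (2 * K)) = τ / 2 := by field_simp
  have h3 : w.energy ≤ τ := by
    have h4 := mul_le_mul_of_nonneg_left huv hK.le
    have h5 : η * ((u.energy + v.energy) / 2) ≤ η * |M| :=
      mul_le_mul_of_nonneg_left (by linarith [le_abs_self M]) hη.le
    linarith
  have hf0 : 0 ≤ (modular p σ w.fn).toReal := ENNReal.toReal_nonneg
  have hg0 : 0 ≤ (modular p σ w.grad).toReal := ENNReal.toReal_nonneg
  unfold energy at h3
  have hwn : ‖w‖ ≤ 2 * ε' := norm_le_of_modular_le hε' (min_le_right _ _)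
    ((ENNReal.le_ofReal_iff_toReal_le w.modular_fn_lt_top.ne hτ.le).2 (by linarith))
    ((ENNReal.le_ofReal_iff_toReal_le w.modular_grad_lt_top.ne hτ.le).2 (by linarith))
  rw [hw, norm_smul, Real.norm_of_nonneg (by norm_num)] at hwn
  linarith [min_le_left (ε / 4) 1]

instance separableSpace (p : BoundedExponent Ω) (σ : Weight d) :
    SeparableSpace (SmoothSpace p σ) := by
  have hf := fun u : SmoothSpace p σ =>
    memLp_mazur p σ u.aestronglyMeasurable_fn u.modular_fn_lt_top
  have hg := fun u : SmoothSpace p σ =>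
    memLp_mazur p σ u.aestronglyMeasurable_grad u.modular_grad_lt_top
  have : Fact ((1 : ℝ≥0∞) ≠ ⊤) := ⟨ENNReal.one_ne_top⟩
  have : SecondCountableTopology (Lp ℝ 1 (domainMeasure Ω)) := Lp.SecondCountableTopology
  have : SecondCountableTopology (Lp (EuclideanSpace ℝ (Fin d)) 1 (domainMeasure Ω)) :=
    Lp.SecondCountableTopology
  refine separableSpace_of_dist_lt (fun u => ((hf u).toLp _, (hg u).toLp _)) fun ε hε => ?_
  set ε' := min (ε / 4) 1
  have hε' : 0 < ε' := by positivity
  -- The divisor is the constant `2 ^ p⁺` of the inverse Mazur estimate.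
  refine ⟨ε' ^ p.upper / 2 ^ p.upper, by positivity, fun u v huv => ?_⟩
  rw [Prod.dist_eq, max_lt_iff, lt_div_iff₀' (by positivity), lt_div_iff₀' (by positivity)] at huv
  have h1 : modular p σ (u - v).grad = modular p σ fun x => u.grad x - v.grad x :=
    modular_congr p σ (grad_sub u v)
  rw [dist_eq_norm]
  have h2 : ‖u - v‖ ≤ 2 * ε' := norm_le_of_modular_le hε' (min_le_right _ _)
    ((modular_sub_le_dist p σ (hf u) (hf v)).trans (ENNReal.ofReal_le_ofReal huv.1.le))
    (h1 ▸ (modular_sub_le_dist p σ (hg u) (hg v)).trans (ENNReal.ofReal_le_ofReal huv.2.le))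
  linarith [min_le_left (ε / 4) 1]

end SmoothSpace

theorem H1.isReflexive (σ : Weight d) (hp : 1 < p.lower) : IsReflexive (H1 p σ) := by
  refine isReflexive_of_uniformlyConvex
    (UniformSpace.Completion.toComplₗᵢ (𝕜 := ℝ) (E := SmoothSpace p σ)).toLinearMap
    UniformSpace.Completion.denseRange_coe SmoothSpace.energy SmoothSpace.energy_nonneg
    -- `|R| + 1` is at least `1` and exceeds `R`, as `energy_le` demands.
    (fun R => ⟨2 * (|R| + 1) ^ p.upper, fun u hu => ?_⟩) fun M ε hε => ?_
  · have h : ‖u‖ ≤ R := by simpa using hu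
    exact SmoothSpace.energy_le (by simp) (by linarith [le_abs_self R])
  · obtain ⟨δ, hδ, h⟩ := SmoothSpace.energy_uniformlyConvex (σ := σ) hp M ε hε
    refine ⟨δ, hδ, fun u v hu hv huv => ?_⟩
    rw [← map_sub]
    simpa using h u v hu hv huv

end Sobolev

end WeightedVariableSobolev

end

theorem theorem6p4 {d : ℕ} (Ω : TopologicalSpace.Opens (EuclideanSpace ℝ (Fin d)))
    (p : WeightedVariableSobolev.BoundedExponent Ω) (hp : 1 < p.lower)
    (σ : WeightedVariableSobolev.Weight d)
    (hσ : WeightedVariableSobolev.Admissible p σ) :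
    CompleteSpace (WeightedVariableSobolev.H1 p σ) ∧
      TopologicalSpace.SeparableSpace (WeightedVariableSobolev.H1 p σ) ∧
      WeightedVariableSobolev.IsReflexive (WeightedVariableSobolev.H1 p σ) :=
  -- A completion is complete and inherits separability from its dense subspace.
  ⟨inferInstance, inferInstance, WeightedVariableSobolev.H1.isReflexive σ hp⟩
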